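/- Let $H$ be a separable complex Hilbert space and let $p>0$ be real. For a bounded operator $A$ on $H$ put $|A|=(A^*A)^{1/2}$. The Schatten class $C_p$ is the set of compact operators $A$ on $H$ with $\operatorname{tr}|A|^p<\infty$, and for $A\in C_p$ put $\|A\|_p=(\operatorname{tr}|A|^p)^{1/p}$. Theorem. Let $A_1,\dots,A_n\in C_p$ have pairwise orthogonal ranges, i.e. $\operatorname{ran}A_i\perp\operatorname{ran}A_j$ (equivalently $A_i^*A_j=0$) for $i\ne j$. Then $A_i\pm A_j\in C_p$ for all $i,j$, and the following hold, in each of them either with the upper sign throughout or with the lower sign throughout. (a) If $0<p\le 2$, then $$(2n\pm 2)^{p/2}\,n^{p/2-1}\sum_{i=1}^n\|A_i\|_p^p\;\le\;\sum_{i,j=1}^n\|A_i\pm A_j\|_p^p .$$ (b) If $2\le p<\infty$, then $$\sum_{i,j=1}^n\|A_i\pm A_j\|_p^p\;\le\;(2n\pm 2)^{p/2}\,n^{p/2-1}\sum_{i=1}^n\|A_i\|_p^p .$$ -/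

import Mathlib

open scoped ENNReal InnerProductSpace

/-- The trace `∑ₖ ⟪eₖ, T eₖ⟫ ∈ [0, ∞]` of a positive operator `T`, for an orthonormal basis `(eₖ)`
of `H`. By `posTrace_eq_tsum` it does not depend on the basis. -/
noncomputable def posTrace {H : Type*} [NormedAddCommGroup H] [InnerProductSpace ℂ H]
    [CompleteSpace H] (T : H →L[ℂ] H) : ℝ≥0∞ :=
  ∑' k, ENNReal.ofReal (⟪(exists_hilbertBasis ℂ H).choose_spec.choose k,
    T ((exists_hilbertBasis ℂ H).choose_spec.choose k)⟫_ℂ).re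

theorem HilbertBasis.tsum_ofReal_norm_inner_sq {ι H : Type*} [NormedAddCommGroup H]
    [InnerProductSpace ℂ H] (b : HilbertBasis ι ℂ H) (x : H) :
    ∑' k, ENNReal.ofReal (‖⟪b k, x⟫_ℂ‖ ^ 2) = ENNReal.ofReal (‖x‖ ^ 2) := by
  have h := b.hasSum_inner_mul_inner x x
  have h2 := (Complex.reCLM.hasSum h)
  have h3 : HasSum (fun k => ‖⟪b k, x⟫_ℂ‖ ^ 2) (‖x‖ ^ 2) := by
    convert h2 using 1
    · funext k
      rw [← inner_conj_symm x (b k), Complex.conj_mul', ← Complex.ofReal_pow]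
      rfl
    · simp [inner_self_eq_norm_sq_to_K, ← Complex.ofReal_pow]
  rw [← h3.tsum_eq, ENNReal.ofReal_tsum_of_nonneg (fun _ => by positivity) h3.summable]

/-- The trace of a positive operator may be computed in any orthonormal basis. -/
theorem posTrace_eq_tsum {ι H : Type*} [NormedAddCommGroup H] [InnerProductSpace ℂ H]
    [CompleteSpace H] {T : H →L[ℂ] H} (hT : 0 ≤ T) (b : HilbertBasis ι ℂ H) :
    posTrace T = ∑' k, ENNReal.ofReal (⟪b k, T (b k)⟫_ℂ).re := by
  set S := CFC.sqrt T
  have hS : IsSelfAdjoint S := (CFC.sqrt_nonneg T).isSelfAdjoint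
  have hST : ∀ x y, ⟪S x, y⟫_ℂ = ⟪x, S y⟫_ℂ := fun x y =>
    (ContinuousLinearMap.isSelfAdjoint_iff_isSymmetric.mp hS) x y
  have key : ∀ x, (⟪x, T x⟫_ℂ).re = ‖S x‖ ^ 2 := by
    intro x
    have : T = S * S := (CFC.sqrt_mul_sqrt_self T hT).symm
    rw [this, mul_apply_eq_comp, ← hST]
    simp [inner_self_eq_norm_sq_to_K, ← Complex.ofReal_pow]
  unfold posTrace
  generalize (exists_hilbertBasis ℂ H).choose_spec.choose = e
  simp only [key]
  calc ∑' k, ENNReal.ofReal (‖S (e k)‖ ^ 2)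
      = ∑' k, ∑' j, ENNReal.ofReal (‖⟪b j, S (e k)⟫_ℂ‖ ^ 2) := by
        simp only [b.tsum_ofReal_norm_inner_sq]
    _ = ∑' j, ∑' k, ENNReal.ofReal (‖⟪b j, S (e k)⟫_ℂ‖ ^ 2) := ENNReal.tsum_comm
    _ = ∑' j, ∑' k, ENNReal.ofReal (‖⟪e k, S (b j)⟫_ℂ‖ ^ 2) := by
        simp only [← hST, norm_inner_symm]
    _ = ∑' j, ENNReal.ofReal (‖S (b j)‖ ^ 2) := by
        simp only [e.tsum_ofReal_norm_inner_sq]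

/-- `tr |A| ^ p ∈ [0, ∞]`, where `|A| = (A* A) ^ (1/2)` and the powers are those of the continuous
functional calculus. -/
noncomputable def schattenTrace {H : Type*} [NormedAddCommGroup H] [InnerProductSpace ℂ H]
    [CompleteSpace H] (p : ℝ) (A : H →L[ℂ] H) : ℝ≥0∞ :=
  posTrace (CFC.rpow (CFC.abs A) p)

/-- The Schatten `p`-class: the compact operators `A` with `tr |A| ^ p < ∞`, for `p > 0`. -/
def schattenClass (H : Type*) [NormedAddCommGroup H] [InnerProductSpace ℂ H]
    [CompleteSpace H] (p : ℝ) : Set (H →L[ℂ] H) :=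
  {A | IsCompactOperator A ∧ schattenTrace p A < ∞}

/-- The Schatten `p`-(quasi-)norm `‖A‖ₚ = (tr |A| ^ p) ^ (1/p)` of `A` in the Schatten `p`-class. -/
noncomputable def schattenNorm {H : Type*} [NormedAddCommGroup H] [InnerProductSpace ℂ H]
    [CompleteSpace H] (p : ℝ) (A : H →L[ℂ] H) : ℝ :=
  (schattenTrace p A).toReal ^ (1 / p)

/-! Put q = p/2, so tr|A|^p = tr (A*A)^q. Since A_i*A_j = 0 for i ≠ j, the operators D_ij = A_i ±
A_j satisfy Σ D_ij*D_ij = (2n ± 2) Σ A_i*A_i. It remains to compare tr (Σ X_i)^q with Σ tr X_i^q for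
compact X_i ≥ 0, in two ways. For q ≥ 1, McCarthy's inequality (`sum_posTrace_rpow_le`) is applied
to the D_ij*D_ij, and convexity (`posTrace_rpow_sum_le`) to the n operators A_i*A_i, which produces
n^(q-1). For q ≤ 1 both inequalities reverse.

All four trace inequalities reduce to the tangent line of s ↦ s^q, averaged against the weights
|⟪b_k, v⟫|² of a unit vector v in an eigenbasis. McCarthy's inequality rests on comparing tr X^q
with tr S^(q-1) X for 0 ≤ X ≤ S, which is then summed over X = X_i with S = Σ X_i. -/

/-- `b` is an orthonormal basis of eigenvectors of `T` with eigenvalues `l k ≥ 0`. -/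
structure IsEigenbasis {ι H : Type*} [NormedAddCommGroup H] [InnerProductSpace ℂ H]
    (T : H →L[ℂ] H) (b : HilbertBasis ι ℂ H) (l : ι → ℝ) : Prop where
  nonneg : ∀ k, 0 ≤ l k
  apply_eq : ∀ k, T (b k) = (l k : ℂ) • b k

/-! ### Eigenbases of compact positive operators and their powers. -/

section Operators

universe u

variable {H : Type u} [NormedAddCommGroup H] [InnerProductSpace ℂ H] [CompleteSpace H]

/-- A compact positive operator has an orthonormal basis of eigenvectors. -/
theorem exists_isEigenbasis {T : H →L[ℂ] H} (hT : 0 ≤ T) (hc : IsCompactOperator T) :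
    ∃ (ι : Type u) (b : HilbertBasis ι ℂ H) (l : ι → ℝ), IsEigenbasis T b l := by
  have hpos : T.IsPositive := (ContinuousLinearMap.nonneg_iff_isPositive T).1 hT
  have hsym : T.IsSymmetric := hpos.isSymmetric
  let E : ℂ → Submodule ℂ H := fun μ => Module.End.eigenspace (T : Module.End ℂ H) μ
  have hE : ∀ μ x, x ∈ E μ ↔ T x = μ • x := fun μ x => Module.End.mem_eigenspace_iff
  have hcompl : ∀ μ, CompleteSpace (E μ) := by
    intro μ
    have hcl : IsClosed (E μ : Set H) := by
      have : (E μ : Set H) = {x | T x = μ • x} := by ext x; exact hE μ x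
      rw [this]
      exact isClosed_eq T.continuous (continuous_const_smul μ)
    exact hcl.completeSpace_coe
  have hex : ∀ μ, ∃ w : Set (E μ), Nonempty (HilbertBasis w ℂ (E μ)) := fun μ => by
    obtain ⟨w, b, -⟩ := exists_hilbertBasis ℂ (E μ)
    exact ⟨w, ⟨b⟩⟩
  choose w hw using hex
  let c : ∀ μ, HilbertBasis (w μ) ℂ (E μ) := fun μ => (hw μ).some
  let v : (Σ μ, w μ) → H := fun a => (c a.1 a.2 : H)
  have hv : Orthonormal ℂ v :=
    (LinearMap.IsSymmetric.orthogonalFamily_eigenspaces hsym).orthonormal_sigma_orthonormal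
      (fun μ => (c μ).orthonormal)
  have hmem : ∀ a, T (v a) = a.1 • v a := fun a => (hE _ _).1 (c a.1 a.2).2
  -- A vector orthogonal to the chosen basis of every eigenspace is orthogonal to all eigenspaces;
  -- the spectral theorem for compact symmetric operators makes it zero.
  have hspan : (Submodule.span ℂ (Set.range v))ᗮ = ⊥ := by
    rw [eq_bot_iff, ← ContinuousLinearMap.orthogonalComplement_iSup_eigenspaces_eq_bot hc hsym]
    intro x hx
    rw [← Submodule.iInf_orthogonal, Submodule.mem_iInf]
    intro μ
    rw [Submodule.mem_orthogonal']
    intro y hy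
    have h1 := (((E μ).subtypeL.hasSum ((c μ).hasSum_repr ⟨y, hy⟩)).mapL (innerSL ℂ x))
    have h2 : ∀ i, innerSL ℂ x ((E μ).subtypeL ((c μ).repr ⟨y, hy⟩ i • c μ i)) = 0 := by
      intro i
      have : ⟪x, v ⟨μ, i⟩⟫_ℂ = 0 :=
        (Submodule.mem_orthogonal' _ _).1 hx _ (Submodule.subset_span ⟨_, rfl⟩)
      simp only [map_smul, smul_eq_mul]
      exact mul_eq_zero_of_right _ this
    simp only [h2] at h1
    exact h1.unique hasSum_zero
  have hval : ∀ a : (Σ μ, w μ), 0 ≤ a.1.re ∧ a.1 = (a.1.re : ℂ) := by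
    intro a
    have h := hpos.inner_nonneg_right (v a)
    rw [hmem, inner_smul_right, inner_self_eq_norm_sq_to_K, hv.1 a] at h
    simp only [Complex.coe_algebraMap, Complex.ofReal_one, one_pow, mul_one] at h
    rw [Complex.le_def] at h
    refine ⟨by simpa using h.1, Complex.ext (by simp) (by simpa using h.2.symm)⟩
  refine ⟨Σ μ, w μ, HilbertBasis.mkOfOrthogonalEqBot hv hspan, fun a => a.1.re,
    fun a => (hval a).1, fun a => ?_⟩
  rw [HilbertBasis.coe_mkOfOrthogonalEqBot, hmem]
  congr 1
  exact (hval a).2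

/-- An eigenvector of a self-adjoint operator is an eigenvector of its continuous functions. -/
theorem cfc_apply_of_apply_eq_smul {T : H →L[ℂ] H} (hT : IsSelfAdjoint T) {v : H} {t : ℝ}
    (hv : T v = (t : ℂ) • v) {f : ℝ → ℝ} (hf : ContinuousOn f (spectrum ℝ T)) :
    cfc f T v = (f t : ℂ) • v := by
  rcases eq_or_ne v 0 with rfl | hv0
  · simp
  have ht : t ∈ spectrum ℝ T := by
    intro hu
    apply hv0
    obtain ⟨S, hS⟩ := hu.exists_left_inv
    have h0 : (algebraMap ℝ (H →L[ℂ] H) t - T) v = 0 := by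
      rw [Algebra.algebraMap_eq_smul_one]
      simp [hv]
    have := congrArg (fun R : H →L[ℂ] H => R v) hS
    simpa [h0] using this.symm
  -- Stone–Weierstrass: the identity holds for constants and the coordinate, and survives sums,
  -- products and uniform limits.
  have key : ∀ g : C(spectrum ℝ T, ℝ), cfcHom hT g v = (g ⟨t, ht⟩ : ℂ) • v := by
    intro g
    induction g using ContinuousMap.induction_on_of_compact with
    | const r =>
      have : (ContinuousMap.const (spectrum ℝ T) r) = algebraMap ℝ C(spectrum ℝ T, ℝ) r := rfl
      rw [this, AlgHomClass.commutes, Algebra.algebraMap_eq_smul_one]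
      rfl
    | id =>
      rw [cfcHom_id hT, hv]
      rfl
    | star_id =>
      rw [map_star, cfcHom_id hT, hT.star_eq, hv]
      rfl
    | add f g hf hg => simp [hf, hg, add_smul]
    | mul f g hf hg =>
      rw [map_mul, mul_apply_eq_comp, hg, map_smul, hf, smul_smul, ContinuousMap.mul_apply,
        Complex.ofReal_mul, mul_comm]
    | frequently f h =>
      have hcl : IsClosed {g : C(spectrum ℝ T, ℝ) | cfcHom hT g v = (g ⟨t, ht⟩ : ℂ) • v} := by
        refine isClosed_eq ?_ ?_
        · exact (ContinuousLinearMap.apply ℂ H v).continuous.comp (cfcHom_continuous hT)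
        · exact (Complex.continuous_ofReal.comp (continuous_eval_const _)).smul
            continuous_const
      exact hcl.mem_of_frequently_of_tendsto h Filter.tendsto_id
  rw [cfc_apply f T hT hf, key]
  rfl

theorem rpow_apply_of_apply_eq_smul {T : H →L[ℂ] H} (hT : 0 ≤ T) {v : H} {t q : ℝ} (hq : 0 ≤ q)
    (hv : T v = (t : ℂ) • v) : CFC.rpow T q v = ((t ^ q : ℝ) : ℂ) • v := by
  rw [CFC.rpow_eq_pow, CFC.rpow_eq_cfc_real hT]
  exact cfc_apply_of_apply_eq_smul hT.isSelfAdjoint hv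
    (Real.continuous_rpow_const hq).continuousOn

namespace IsEigenbasis

variable {ι : Type*} {T : H →L[ℂ] H} {b : HilbertBasis ι ℂ H} {l : ι → ℝ}

theorem rpow (h : IsEigenbasis T b l) (hT : 0 ≤ T) {q : ℝ} (hq : 0 ≤ q) :
    IsEigenbasis (CFC.rpow T q) b (fun k => l k ^ q) :=
  ⟨fun k => Real.rpow_nonneg (h.nonneg k) q,
    fun k => rpow_apply_of_apply_eq_smul hT hq (h.apply_eq k)⟩

omit [CompleteSpace H] in
theorem inner_apply_self (h : IsEigenbasis T b l) (k : ι) : (⟪b k, T (b k)⟫_ℂ).re = l k := by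
  rw [h.apply_eq, inner_smul_right, inner_self_eq_norm_sq_to_K, b.orthonormal.1 k]
  simp

theorem posTrace_eq (h : IsEigenbasis T b l) (hT : 0 ≤ T) :
    posTrace T = ∑' k, ENNReal.ofReal (l k) := by
  rw [posTrace_eq_tsum hT b]
  simp only [h.inner_apply_self]

theorem posTrace_rpow_eq (h : IsEigenbasis T b l) (hT : 0 ≤ T) {q : ℝ} (hq : 0 ≤ q) :
    posTrace (CFC.rpow T q) = ∑' k, ENNReal.ofReal (l k ^ q) :=
  (h.rpow hT hq).posTrace_eq CFC.rpow_nonneg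

omit [CompleteSpace H] in
theorem hasSum_re_inner (h : IsEigenbasis T b l) (hT : 0 ≤ T) (v : H) :
    HasSum (fun k => l k * ‖⟪b k, v⟫_ℂ‖ ^ 2) (⟪v, T v⟫_ℂ).re := by
  have hsym : ∀ x y, ⟪T x, y⟫_ℂ = ⟪x, T y⟫_ℂ :=
    ((ContinuousLinearMap.nonneg_iff_isPositive T).1 hT).isSymmetric
  convert Complex.reCLM.hasSum (b.hasSum_inner_mul_inner v (T v)) using 1
  on_goal 2 => rfl
  funext k
  rw [← hsym, h.apply_eq, inner_smul_left, Complex.conj_ofReal, mul_left_comm,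
    ← inner_conj_symm v (b k), Complex.conj_mul', ← Complex.ofReal_pow, ← Complex.ofReal_mul]
  rfl

end IsEigenbasis

theorem HilbertBasis.hasSum_norm_inner_sq {ι : Type*} (b : HilbertBasis ι ℂ H) (v : H) :
    HasSum (fun k => ‖⟪b k, v⟫_ℂ‖ ^ 2) (‖v‖ ^ 2) := by
  have h : IsEigenbasis (1 : H →L[ℂ] H) b (fun _ => 1) := ⟨fun _ => zero_le_one, by simp⟩
  have := h.hasSum_re_inner zero_le_one v
  simpa [inner_self_eq_norm_sq_to_K, ← Complex.ofReal_pow] using this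

end Operators

/-! ### Scalar inequalities for powers. -/

namespace Real

/-- The convex function s ↦ s^q lies above its tangent at x: Bernoulli's inequality at s/x - 1,
scaled by x^q. -/
theorem mul_rpow_sub_one_mul_le {q s x : ℝ} (hq : 1 ≤ q) (hs : 0 ≤ s) (hx : 0 < x) :
    q * x ^ (q - 1) * s ≤ s ^ q + (q - 1) * x ^ q := by
  have h := one_add_mul_self_le_rpow_one_add (s := s / x - 1) (by linarith [div_nonneg hs hx.le]) hq
  rw [add_sub_cancel, div_rpow hs hx.le, le_div_iff₀ (rpow_pos_of_pos hx q)] at h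
  have hxq : x ^ q = x ^ (q - 1) * x := by rw [← rpow_add_one hx.ne', sub_add_cancel]
  have : s / x * x ^ q = x ^ (q - 1) * s := by rw [hxq]; field_simp
  linear_combination h - q * this

theorem rpow_le_mul_rpow_sub_one_mul {q s x : ℝ} (hq0 : 0 ≤ q) (hq : q ≤ 1) (hs : 0 ≤ s)
    (hx : 0 < x) : s ^ q ≤ q * x ^ (q - 1) * s + (1 - q) * x ^ q := by
  have h := rpow_one_add_le_one_add_mul_self (s := s / x - 1)
    (by linarith [div_nonneg hs hx.le]) hq0 hq
  rw [add_sub_cancel, div_rpow hs hx.le, div_le_iff₀ (rpow_pos_of_pos hx q)] at h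
  have hxq : x ^ q = x ^ (q - 1) * x := by rw [← rpow_add_one hx.ne', sub_add_cancel]
  have : s / x * x ^ q = x ^ (q - 1) * s := by rw [hxq]; field_simp
  linear_combination h + q * this

/-- The power mean inequality with exponent 1/q ≥ 1, applied to the numbers t_i^q and raised to the
power q. -/
theorem card_rpow_mul_sum_rpow_le {κ : Type*} [Fintype κ] {q : ℝ} (hq0 : 0 < q) (hq : q ≤ 1)
    {t : κ → ℝ} (ht : ∀ i, 0 ≤ t i) :
    (Fintype.card κ : ℝ) ^ (q - 1) * ∑ i, t i ^ q ≤ (∑ i, t i) ^ q := by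
  rcases isEmpty_or_nonempty κ with h | h
  · simp [zero_rpow hq0.ne']
  have hN : (0 : ℝ) < Fintype.card κ := by exact_mod_cast Fintype.card_pos
  have h2 := rpow_sum_le_const_mul_sum_rpow_of_nonneg (Finset.univ : Finset κ)
    (f := fun i => t i ^ q) (one_le_inv_iff₀.2 ⟨hq0, hq⟩) (fun i _ => rpow_nonneg (ht i) q)
  have h3 : ∀ i, (t i ^ q) ^ q⁻¹ = t i := fun i => rpow_rpow_inv (ht i) hq0.ne'
  have h4 : 0 ≤ ∑ i, t i ^ q := Finset.sum_nonneg fun i _ => rpow_nonneg (ht i) q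
  have h5 := rpow_le_rpow (rpow_nonneg h4 _) h2 hq0.le
  simp only [h3, Finset.card_univ] at h5
  rw [rpow_inv_rpow h4 hq0.ne', mul_rpow (rpow_nonneg hN.le _)
    (Finset.sum_nonneg fun i _ => ht i), ← rpow_mul hN.le, sub_mul, inv_mul_cancel₀ hq0.ne',
    one_mul] at h5
  calc _ ≤ (Fintype.card κ : ℝ) ^ (q - 1) * ((Fintype.card κ : ℝ) ^ (1 - q) * (∑ i, t i) ^ q) :=
        mul_le_mul_of_nonneg_left h5 (rpow_nonneg hN.le _)
    _ = (∑ i, t i) ^ q := by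
        rw [← mul_assoc, ← rpow_add hN, sub_add_sub_cancel, sub_self, rpow_zero, one_mul]

end Real

/-! ### Jensen's inequality and convexity of the trace. -/

section Jensen

universe u

variable {H : Type u} [NormedAddCommGroup H] [InnerProductSpace ℂ H] [CompleteSpace H]

omit [CompleteSpace H] in
theorem ContinuousLinearMap.re_inner_apply_nonneg {T : H →L[ℂ] H} (hT : 0 ≤ T) (v : H) :
    0 ≤ (⟪v, T v⟫_ℂ).re :=
  ((ContinuousLinearMap.nonneg_iff_isPositive T).1 hT).re_inner_nonneg_right v

/-- Jensen's inequality for the vector state of a unit vector. -/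
theorem re_inner_rpow_le {X : H →L[ℂ] H} (hX : 0 ≤ X) (hc : IsCompactOperator X) {q : ℝ}
    (hq : 1 ≤ q) {e : H} (he : ‖e‖ = 1) :
    (⟪e, X e⟫_ℂ).re ^ q ≤ (⟪e, CFC.rpow X q e⟫_ℂ).re := by
  have hq0 : 0 < q := by linarith
  have hR := ContinuousLinearMap.re_inner_apply_nonneg (T := CFC.rpow X q) CFC.rpow_nonneg e
  rcases (ContinuousLinearMap.re_inner_apply_nonneg hX e).eq_or_lt with h0 | ht
  · rw [← h0, Real.zero_rpow hq0.ne']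
    exact hR
  obtain ⟨ι, b, l, h⟩ := exists_isEigenbasis hX hc
  set t := (⟪e, X e⟫_ℂ).re
  have h1 := h.hasSum_re_inner hX e
  have h2 := (h.rpow hX hq0.le).hasSum_re_inner CFC.rpow_nonneg e
  have h3 := b.hasSum_norm_inner_sq e
  -- Tangent at the mean t, averaged over the weights |⟪b_k, e⟫|², which sum to 1.
  have key := hasSum_le (fun k => ?_) (h1.mul_left (q * t ^ (q - 1)))
    (h2.add (h3.mul_left ((q - 1) * t ^ q)))
  · have htq : t ^ q = t ^ (q - 1) * t := by rw [← Real.rpow_add_one ht.ne', sub_add_cancel]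
    rw [he] at key
    linear_combination key + q * htq
  · have := mul_le_mul_of_nonneg_right
      (Real.mul_rpow_sub_one_mul_le hq (h.nonneg k) ht) (sq_nonneg ‖⟪b k, e⟫_ℂ‖)
    linear_combination this

/-- The reverse Jensen inequality for exponents at most one. -/
theorem re_inner_le_rpow {X : H →L[ℂ] H} (hX : 0 ≤ X) (hc : IsCompactOperator X) {q : ℝ}
    (hq0 : 0 < q) (hq : q ≤ 1) {e : H} (he : ‖e‖ = 1) :
    (⟪e, CFC.rpow X q e⟫_ℂ).re ≤ (⟪e, X e⟫_ℂ).re ^ q := by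
  obtain ⟨ι, b, l, h⟩ := exists_isEigenbasis hX hc
  have h1 := h.hasSum_re_inner hX e
  have h2 := (h.rpow hX hq0.le).hasSum_re_inner CFC.rpow_nonneg e
  have h3 := b.hasSum_norm_inner_sq e
  -- There is no tangent to use at t = 0; there e only meets eigenvectors of eigenvalue 0, so both
  -- sides vanish.
  rcases (ContinuousLinearMap.re_inner_apply_nonneg hX e).eq_or_lt with h0 | ht
  · rw [← h0, Real.zero_rpow hq0.ne']
    rw [← h0, hasSum_zero_iff_of_nonneg
      (fun k => mul_nonneg (h.nonneg k) (sq_nonneg _))] at h1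
    have h4 : ∀ k, l k ^ q * ‖⟪b k, e⟫_ℂ‖ ^ 2 = 0 := by
      intro k
      rcases mul_eq_zero.1 (congrFun h1 k) with hk | hk
      · rw [hk, Real.zero_rpow hq0.ne', zero_mul]
      · rw [hk, mul_zero]
    simp only [h4] at h2
    exact (h2.unique hasSum_zero).le
  set t := (⟪e, X e⟫_ℂ).re
  have key := hasSum_le (fun k => ?_) h2
    ((h1.mul_left (q * t ^ (q - 1))).add (h3.mul_left ((1 - q) * t ^ q)))
  · have htq : t ^ q = t ^ (q - 1) * t := by rw [← Real.rpow_add_one ht.ne', sub_add_cancel]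
    rw [he] at key
    linear_combination key - q * htq
  · have := mul_le_mul_of_nonneg_right
      (Real.rpow_le_mul_rpow_sub_one_mul hq0.le hq (h.nonneg k) ht) (sq_nonneg ‖⟪b k, e⟫_ℂ‖)
    linear_combination this

variable {κ : Type*} [Fintype κ] {X : κ → H →L[ℂ] H}

omit [CompleteSpace H] in
theorem isCompactOperator_sum (hc : ∀ i, IsCompactOperator (X i)) :
    IsCompactOperator (∑ i, X i : H →L[ℂ] H) :=
  (Submodule.sum_mem (compactOperator (RingHom.id ℂ) H H) (fun i _ => hc i) :)

omit [CompleteSpace H] in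
theorem IsEigenbasis.sum_re_inner_apply {ι : Type*} {b : HilbertBasis ι ℂ H} {s : ι → ℝ}
    (h : IsEigenbasis (∑ i, X i) b s) (k : ι) : ∑ i, (⟪b k, X i (b k)⟫_ℂ).re = s k := by
  rw [← h.inner_apply_self k, sum_apply, inner_sum, Complex.re_sum]

/-- Convexity of `T ↦ tr T ^ q` for `q ≥ 1`. -/
theorem posTrace_rpow_sum_le (hX : ∀ i, 0 ≤ X i) (hc : ∀ i, IsCompactOperator (X i)) {q : ℝ}
    (hq : 1 ≤ q) :
    posTrace (CFC.rpow (∑ i, X i) q) ≤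
      ENNReal.ofReal ((Fintype.card κ : ℝ) ^ (q - 1)) * ∑ i, posTrace (CFC.rpow (X i) q) := by
  have hS : 0 ≤ ∑ i, X i := Finset.sum_nonneg fun i _ => hX i
  -- In an eigenbasis of the sum, each eigenvalue is the sum of the diagonal entries of the X_i, so
  -- the power mean inequality and then Jensen apply entry by entry.
  obtain ⟨ι, b, s, h⟩ := exists_isEigenbasis hS (isCompactOperator_sum hc)
  rw [h.posTrace_rpow_eq hS (by linarith)]
  simp only [fun i => posTrace_eq_tsum (T := CFC.rpow (X i) q) CFC.rpow_nonneg b]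
  rw [← Summable.tsum_finsetSum fun _ _ => ENNReal.summable, ← ENNReal.tsum_mul_left]
  refine ENNReal.tsum_le_tsum fun k => ?_
  rw [← ENNReal.ofReal_sum_of_nonneg fun i _ =>
      ContinuousLinearMap.re_inner_apply_nonneg (T := CFC.rpow (X i) q) CFC.rpow_nonneg _,
    ← ENNReal.ofReal_mul (by positivity)]
  refine ENNReal.ofReal_le_ofReal ?_
  rw [← h.sum_re_inner_apply k]
  refine (Real.rpow_sum_le_const_mul_sum_rpow_of_nonneg _ hq fun i _ =>
    ContinuousLinearMap.re_inner_apply_nonneg (hX i) _).trans ?_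
  rw [Finset.card_univ]
  gcongr with i
  exact re_inner_rpow_le (hX i) (hc i) hq (b.orthonormal.1 k)

/-- Concavity of `T ↦ tr T ^ q` for `0 < q ≤ 1`. -/
theorem le_posTrace_rpow_sum (hX : ∀ i, 0 ≤ X i) (hc : ∀ i, IsCompactOperator (X i)) {q : ℝ}
    (hq0 : 0 < q) (hq : q ≤ 1) :
    ENNReal.ofReal ((Fintype.card κ : ℝ) ^ (q - 1)) * ∑ i, posTrace (CFC.rpow (X i) q) ≤
      posTrace (CFC.rpow (∑ i, X i) q) := by
  have hS : 0 ≤ ∑ i, X i := Finset.sum_nonneg fun i _ => hX i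
  obtain ⟨ι, b, s, h⟩ := exists_isEigenbasis hS (isCompactOperator_sum hc)
  rw [h.posTrace_rpow_eq hS hq0.le]
  simp only [fun i => posTrace_eq_tsum (T := CFC.rpow (X i) q) CFC.rpow_nonneg b]
  rw [← Summable.tsum_finsetSum fun _ _ => ENNReal.summable, ← ENNReal.tsum_mul_left]
  refine ENNReal.tsum_le_tsum fun k => ?_
  rw [← ENNReal.ofReal_sum_of_nonneg fun i _ =>
      ContinuousLinearMap.re_inner_apply_nonneg (T := CFC.rpow (X i) q) CFC.rpow_nonneg _,
    ← ENNReal.ofReal_mul (by positivity)]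
  refine ENNReal.ofReal_le_ofReal ?_
  rw [← h.sum_re_inner_apply k]
  refine le_trans ?_ (Real.card_rpow_mul_sum_rpow_le hq0 hq fun i =>
    ContinuousLinearMap.re_inner_apply_nonneg (hX i) _)
  gcongr with i
  exact re_inner_le_rpow (hX i) (hc i) hq0 hq (b.orthonormal.1 k)

end Jensen

/-! ### McCarthy's trace inequalities. -/

section McCarthy

universe u

/-- Divide the tangent line inequality at x by s_j and average against p: the bound on Σ p_j/s_j
controls the term (q-1)x^q/s_j. Since p_j = 0 wherever s_j = 0, the convention for division by zero
is harmless. -/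
theorem ofReal_rpow_le_tsum {ι : Type*} {p s : ι → ℝ} {x q : ℝ} (hp : ∀ j, 0 ≤ p j)
    (hs : ∀ j, 0 ≤ s j) (hx : 0 < x) (hsp : ∀ j, s j = 0 → p j = 0)
    (h1 : ∑' j, ENNReal.ofReal (p j) = 1)
    (h2 : ∑' j, ENNReal.ofReal (p j / s j) ≤ ENNReal.ofReal x⁻¹) (hq : 1 ≤ q) :
    ENNReal.ofReal (x ^ (q - 1)) ≤ ∑' j, ENNReal.ofReal (s j ^ (q - 1) * p j) := by
  have hxq : x ^ q = x ^ (q - 1) * x := by rw [← Real.rpow_add_one hx.ne', sub_add_cancel]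
  have hpow : 0 ≤ x ^ (q - 1) := Real.rpow_nonneg hx.le _
  have hq1 : 0 ≤ q - 1 := by linarith
  have hpt : ∀ j, ENNReal.ofReal (q * x ^ (q - 1)) * ENNReal.ofReal (p j) ≤
      ENNReal.ofReal (s j ^ (q - 1) * p j) +
        ENNReal.ofReal ((q - 1) * x ^ q) * ENNReal.ofReal (p j / s j) := by
    intro j
    rw [← ENNReal.ofReal_mul (by positivity), ← ENNReal.ofReal_mul (by positivity),
      ← ENNReal.ofReal_add (mul_nonneg (Real.rpow_nonneg (hs j) _) (hp j))
        (mul_nonneg (by positivity) (div_nonneg (hp j) (hs j)))]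
    refine ENNReal.ofReal_le_ofReal ?_
    rcases (hs j).eq_or_lt with h0 | h0
    · simp [hsp j h0.symm]
    have := mul_le_mul_of_nonneg_right (Real.mul_rpow_sub_one_mul_le hq (hs j) hx)
      (div_nonneg (hp j) (hs j))
    have e1 : s j * (p j / s j) = p j := by field_simp
    have e2 : s j ^ q = s j ^ (q - 1) * s j := by
      rw [← Real.rpow_add_one h0.ne', sub_add_cancel]
    linear_combination this + (s j ^ (q - 1) - q * x ^ (q - 1)) * e1 + (p j / s j) * e2
  have hsum := ENNReal.tsum_le_tsum hpt
  rw [ENNReal.tsum_add, ENNReal.tsum_mul_left, ENNReal.tsum_mul_left, h1, mul_one] at hsum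
  have hle : ENNReal.ofReal (x ^ (q - 1)) + ENNReal.ofReal ((q - 1) * x ^ (q - 1)) ≤
      ∑' j, ENNReal.ofReal (s j ^ (q - 1) * p j) + ENNReal.ofReal ((q - 1) * x ^ (q - 1)) := by
    rw [← ENNReal.ofReal_add hpow (by positivity)]
    refine le_trans (le_of_eq ?_) (hsum.trans (add_le_add_right
      ((mul_le_mul_right h2 _).trans (le_of_eq ?_)) _))
    · congr 1; ring
    · rw [← ENNReal.ofReal_mul (by positivity), hxq]
      congr 1
      field_simp
  exact ENNReal.le_of_add_le_add_right ENNReal.ofReal_ne_top hle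

theorem tsum_le_ofReal_rpow {ι : Type*} {p s : ι → ℝ} {x q : ℝ} (hp : ∀ j, 0 ≤ p j)
    (hs : ∀ j, 0 ≤ s j) (hx : 0 < x) (hsp : ∀ j, s j = 0 → p j = 0)
    (h1 : ∑' j, ENNReal.ofReal (p j) = 1)
    (h2 : ∑' j, ENNReal.ofReal (p j / s j) ≤ ENNReal.ofReal x⁻¹) (hq0 : 0 ≤ q) (hq : q ≤ 1) :
    ∑' j, ENNReal.ofReal (s j ^ (q - 1) * p j) ≤ ENNReal.ofReal (x ^ (q - 1)) := by
  have hxq : x ^ q = x ^ (q - 1) * x := by rw [← Real.rpow_add_one hx.ne', sub_add_cancel]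
  have hpow : 0 ≤ x ^ (q - 1) := Real.rpow_nonneg hx.le _
  have hq1 : 0 ≤ 1 - q := by linarith
  have hpt : ∀ j, ENNReal.ofReal (s j ^ (q - 1) * p j) ≤
      ENNReal.ofReal (q * x ^ (q - 1)) * ENNReal.ofReal (p j) +
        ENNReal.ofReal ((1 - q) * x ^ q) * ENNReal.ofReal (p j / s j) := by
    intro j
    rw [← ENNReal.ofReal_mul (by positivity), ← ENNReal.ofReal_mul (by positivity),
      ← ENNReal.ofReal_add (mul_nonneg (by positivity) (hp j))
        (mul_nonneg (by positivity) (div_nonneg (hp j) (hs j)))]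
    refine ENNReal.ofReal_le_ofReal ?_
    rcases (hs j).eq_or_lt with h0 | h0
    · simp [hsp j h0.symm]
    have := mul_le_mul_of_nonneg_right (Real.rpow_le_mul_rpow_sub_one_mul hq0 hq (hs j) hx)
      (div_nonneg (hp j) (hs j))
    have e1 : s j * (p j / s j) = p j := by field_simp
    have e2 : s j ^ q = s j ^ (q - 1) * s j := by
      rw [← Real.rpow_add_one h0.ne', sub_add_cancel]
    linear_combination this - (s j ^ (q - 1) - q * x ^ (q - 1)) * e1 - (p j / s j) * e2
  have hsum := ENNReal.tsum_le_tsum hpt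
  rw [ENNReal.tsum_add, ENNReal.tsum_mul_left, ENNReal.tsum_mul_left, h1, mul_one] at hsum
  refine hsum.trans ((add_le_add_right (mul_le_mul_right h2 _) _).trans (le_of_eq ?_))
  rw [← ENNReal.ofReal_mul (by positivity), ← ENNReal.ofReal_add (by positivity) (by positivity),
    hxq]
  congr 1
  field_simp
  ring

variable {H : Type u} [NormedAddCommGroup H] [InnerProductSpace ℂ H] [CompleteSpace H]

namespace IsEigenbasis

variable {ι ι' : Type*} {X S : H →L[ℂ] H} {e : HilbertBasis ι ℂ H} {x : ι → ℝ}
  {f : HilbertBasis ι' ℂ H} {s : ι' → ℝ}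

/-- The spectral piece of X along e_k is dominated by X, hence by S. -/
theorem mul_norm_inner_sq_le (hX : 0 ≤ X) (hXS : X ≤ S) (he : IsEigenbasis X e x) (k : ι) (v : H) :
    x k * ‖⟪e k, v⟫_ℂ‖ ^ 2 ≤ (⟪v, S v⟫_ℂ).re := by
  have h1 := le_hasSum (he.hasSum_re_inner hX v) k
    (fun j _ => mul_nonneg (he.nonneg j) (sq_nonneg _))
  have h2 := ContinuousLinearMap.re_inner_apply_nonneg (sub_nonneg.2 hXS) v
  rw [sub_apply, inner_sub_right, Complex.sub_re] at h2
  linarith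

theorem norm_inner_sq_eq_zero (hX : 0 ≤ X) (hXS : X ≤ S) (he : IsEigenbasis X e x)
    (hf : IsEigenbasis S f s) {k : ι} (hk : 0 < x k) {j : ι'} (hj : s j = 0) :
    ‖⟪f j, e k⟫_ℂ‖ ^ 2 = 0 := by
  have h := he.mul_norm_inner_sq_le hX hXS k (f j)
  rw [hf.inner_apply_self, hj, norm_inner_symm] at h
  nlinarith [sq_nonneg ‖⟪f j, e k⟫_ℂ‖]

/-- Formally ⟪e_k, S⁻¹ e_k⟫ ≤ 1/x_k, as inversion reverses order. As S need not be invertible,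
finite truncations of S⁻¹ e_k are used instead. -/
theorem tsum_norm_inner_sq_div_le (hX : 0 ≤ X) (hXS : X ≤ S) (he : IsEigenbasis X e x)
    (hf : IsEigenbasis S f s) {k : ι} (hk : 0 < x k) :
    ∑' j, ENNReal.ofReal (‖⟪f j, e k⟫_ℂ‖ ^ 2 / s j) ≤ ENNReal.ofReal (x k)⁻¹ := by
  classical
  have hnn : ∀ j, 0 ≤ ‖⟪f j, e k⟫_ℂ‖ ^ 2 / s j := fun j => div_nonneg (sq_nonneg _) (hf.nonneg j)
  rw [ENNReal.tsum_eq_iSup_sum]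
  refine iSup_le fun F => ?_
  rw [← ENNReal.ofReal_sum_of_nonneg fun j _ => hnn j]
  refine ENNReal.ofReal_le_ofReal ?_
  set a := ∑ j ∈ F, ‖⟪f j, e k⟫_ℂ‖ ^ 2 / s j with ha
  have ha0 : 0 ≤ a := Finset.sum_nonneg fun j _ => hnn j
  -- With this v both ⟪e_k, v⟫ and ⟪v, S v⟫ equal a, so the rank-one bound reads x_k a² ≤ a.
  let v : H := ∑ j ∈ F, (⟪f j, e k⟫_ℂ / s j) • f j
  have hve : ⟪e k, v⟫_ℂ = (a : ℂ) := by
    simp only [v, ha, inner_sum, inner_smul_right, Complex.ofReal_sum]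
    refine Finset.sum_congr rfl fun j _ => ?_
    rw [← inner_conj_symm (e k) (f j), div_mul_eq_mul_div, Complex.mul_conj']
    push_cast
    rfl
  have hfv : ∀ j, ⟪f j, v⟫_ℂ = if j ∈ F then ⟪f j, e k⟫_ℂ / s j else 0 := by
    intro j
    split_ifs with hj
    · exact f.orthonormal.inner_right_sum _ hj
    · simp only [v, inner_sum, inner_smul_right]
      refine Finset.sum_eq_zero fun i hi => ?_
      rw [f.orthonormal.2 (ne_of_mem_of_not_mem hi hj).symm, mul_zero]
  have hvv : (⟪v, S v⟫_ℂ).re = a := by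
    refine (hf.hasSum_re_inner (hX.trans hXS) v).unique ?_
    have : a = ∑ j ∈ F, s j * ‖⟪f j, v⟫_ℂ‖ ^ 2 := by
      refine Finset.sum_congr rfl fun j hj => ?_
      rw [hfv, if_pos hj, norm_div, Complex.norm_real, Real.norm_of_nonneg (hf.nonneg j)]
      rcases eq_or_ne (s j) 0 with h0 | h0
      · simp [h0]
      · field_simp
    rw [this]
    exact hasSum_sum_of_ne_finset_zero fun j hj => by simp [hfv, hj]
  have h := he.mul_norm_inner_sq_le hX hXS k v
  rw [hve, hvv, Complex.norm_real, Real.norm_of_nonneg ha0] at h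
  rcases ha0.eq_or_lt with h0 | h0
  · rw [← h0]
    positivity
  · rw [le_inv_comm₀ h0 hk, ← one_div, le_div_iff₀ h0]
    nlinarith

omit [CompleteSpace H] in
theorem tsum_norm_inner_sq (e : HilbertBasis ι ℂ H) (f : HilbertBasis ι' ℂ H) (k : ι) :
    ∑' j, ENNReal.ofReal (‖⟪f j, e k⟫_ℂ‖ ^ 2) = 1 := by
  rw [f.tsum_ofReal_norm_inner_sq, e.orthonormal.1 k]
  simp

omit [CompleteSpace H] in
-- Both sides are tr S^r X; expand ⟪f_j, X f_j⟫ in the eigenbasis of X and exchange the sums.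
theorem tsum_rpow_mul_re_inner (hX : 0 ≤ X) (he : IsEigenbasis X e x) (hf : IsEigenbasis S f s)
    (r : ℝ) :
    ∑' j, ENNReal.ofReal (s j ^ r) * ENNReal.ofReal (⟪f j, X (f j)⟫_ℂ).re =
      ∑' k, ENNReal.ofReal (x k) * ∑' j, ENNReal.ofReal (s j ^ r * ‖⟪f j, e k⟫_ℂ‖ ^ 2) := by
  simp only [← ENNReal.tsum_mul_left]
  rw [ENNReal.tsum_comm]
  refine tsum_congr fun j => ?_
  have h := he.hasSum_re_inner hX (f j)
  rw [← h.tsum_eq, ENNReal.ofReal_tsum_of_nonneg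
    (fun k => mul_nonneg (he.nonneg k) (sq_nonneg _)) h.summable, ← ENNReal.tsum_mul_left]
  refine tsum_congr fun k => ?_
  rw [norm_inner_symm, ENNReal.ofReal_mul (he.nonneg k),
    ENNReal.ofReal_mul (Real.rpow_nonneg (hf.nonneg j) r), mul_left_comm]

omit [CompleteSpace H] in
theorem ofReal_rpow_eq (he : IsEigenbasis X e x) {q : ℝ} (hq : 0 < q) (k : ι) :
    ENNReal.ofReal (x k ^ q) = ENNReal.ofReal (x k) * ENNReal.ofReal (x k ^ (q - 1)) := by
  rw [← ENNReal.ofReal_mul (he.nonneg k)]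
  rcases (he.nonneg k).eq_or_lt with h0 | h0
  · rw [← h0, Real.zero_rpow hq.ne', zero_mul]
  · rw [mul_comm, ← Real.rpow_add_one h0.ne', sub_add_cancel]

/-- The core of McCarthy's inequality, tr X^q ≤ tr S^(q-1) X. It holds term by term in the
eigenbasis of X, with the probability weights |⟪f_j, e_k⟫|². -/
theorem posTrace_rpow_le_tsum (hX : 0 ≤ X) (hXS : X ≤ S) (he : IsEigenbasis X e x)
    (hf : IsEigenbasis S f s) {q : ℝ} (hq : 1 ≤ q) :
    posTrace (CFC.rpow X q) ≤
      ∑' j, ENNReal.ofReal (s j ^ (q - 1)) * ENNReal.ofReal (⟪f j, X (f j)⟫_ℂ).re := by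
  rw [tsum_rpow_mul_re_inner hX he hf, he.posTrace_rpow_eq hX (by linarith)]
  refine ENNReal.tsum_le_tsum fun k => ?_
  rw [he.ofReal_rpow_eq (by linarith)]
  rcases (he.nonneg k).eq_or_lt with h0 | h0
  · simp [← h0]
  gcongr
  exact ofReal_rpow_le_tsum (fun j => sq_nonneg _) hf.nonneg h0
    (fun j hj => he.norm_inner_sq_eq_zero hX hXS hf h0 hj) (tsum_norm_inner_sq e f k)
    (he.tsum_norm_inner_sq_div_le hX hXS hf h0) hq

theorem tsum_le_posTrace_rpow (hX : 0 ≤ X) (hXS : X ≤ S) (he : IsEigenbasis X e x)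
    (hf : IsEigenbasis S f s) {q : ℝ} (hq0 : 0 < q) (hq : q ≤ 1) :
    ∑' j, ENNReal.ofReal (s j ^ (q - 1)) * ENNReal.ofReal (⟪f j, X (f j)⟫_ℂ).re ≤
      posTrace (CFC.rpow X q) := by
  rw [tsum_rpow_mul_re_inner hX he hf, he.posTrace_rpow_eq hX hq0.le]
  refine ENNReal.tsum_le_tsum fun k => ?_
  rw [he.ofReal_rpow_eq hq0]
  rcases (he.nonneg k).eq_or_lt with h0 | h0
  · simp [← h0]
  gcongr
  exact tsum_le_ofReal_rpow (fun j => sq_nonneg _) hf.nonneg h0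
    (fun j hj => he.norm_inner_sq_eq_zero hX hXS hf h0 hj) (tsum_norm_inner_sq e f k)
    (he.tsum_norm_inner_sq_div_le hX hXS hf h0) hq0.le hq

/-- This is S^q = Σ S^(q-1) X_i under the trace, which lets the comparison be made for each X_i
separately. -/
theorem posTrace_rpow_sum_eq {κ : Type*} [Fintype κ] {X : κ → H →L[ℂ] H} (hX : ∀ i, 0 ≤ X i)
    (hf : IsEigenbasis (∑ i, X i) f s) {q : ℝ} (hq : 0 < q) :
    posTrace (CFC.rpow (∑ i, X i) q) =
      ∑ i, ∑' j, ENNReal.ofReal (s j ^ (q - 1)) * ENNReal.ofReal (⟪f j, X i (f j)⟫_ℂ).re := by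
  rw [hf.posTrace_rpow_eq (Finset.sum_nonneg fun i _ => hX i) hq.le,
    ← Summable.tsum_finsetSum fun _ _ => ENNReal.summable]
  refine tsum_congr fun j => ?_
  rw [← Finset.mul_sum, ← ENNReal.ofReal_sum_of_nonneg fun i _ =>
    ContinuousLinearMap.re_inner_apply_nonneg (hX i) _, hf.sum_re_inner_apply,
    hf.ofReal_rpow_eq hq, mul_comm]

end IsEigenbasis

variable {κ : Type*} [Fintype κ] {X : κ → H →L[ℂ] H}

/-- **McCarthy's inequality**: `T ↦ tr T ^ q` is superadditive for `q ≥ 1`. -/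
theorem sum_posTrace_rpow_le (hX : ∀ i, 0 ≤ X i) (hc : ∀ i, IsCompactOperator (X i)) {q : ℝ}
    (hq : 1 ≤ q) : ∑ i, posTrace (CFC.rpow (X i) q) ≤ posTrace (CFC.rpow (∑ i, X i) q) := by
  obtain ⟨ι, f, s, hf⟩ := exists_isEigenbasis (Finset.sum_nonneg fun i _ => hX i)
    (isCompactOperator_sum hc)
  rw [hf.posTrace_rpow_sum_eq hX (by linarith)]
  refine Finset.sum_le_sum fun i hi => ?_
  obtain ⟨ι', e, x, he⟩ := exists_isEigenbasis (hX i) (hc i)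
  exact he.posTrace_rpow_le_tsum (hX i)
    (Finset.single_le_sum (fun i _ => hX i) hi) hf hq

/-- **McCarthy's inequality**: `T ↦ tr T ^ q` is subadditive for `0 < q ≤ 1`. -/
theorem posTrace_rpow_sum_le_sum (hX : ∀ i, 0 ≤ X i) (hc : ∀ i, IsCompactOperator (X i)) {q : ℝ}
    (hq0 : 0 < q) (hq : q ≤ 1) :
    posTrace (CFC.rpow (∑ i, X i) q) ≤ ∑ i, posTrace (CFC.rpow (X i) q) := by
  obtain ⟨ι, f, s, hf⟩ := exists_isEigenbasis (Finset.sum_nonneg fun i _ => hX i)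
    (isCompactOperator_sum hc)
  rw [hf.posTrace_rpow_sum_eq hX hq0]
  refine Finset.sum_le_sum fun i hi => ?_
  obtain ⟨ι', e, x, he⟩ := exists_isEigenbasis (hX i) (hc i)
  exact he.tsum_le_posTrace_rpow (hX i)
    (Finset.single_le_sum (fun i _ => hX i) hi) hf hq0 hq

end McCarthy

/-! ### Transfer to Schatten norms and the quadratic identities. -/

section Schatten

universe u

variable {H : Type u} [NormedAddCommGroup H] [InnerProductSpace ℂ H] [CompleteSpace H]

theorem schattenTrace_eq (A : H →L[ℂ] H) {p : ℝ} (hp : 0 ≤ p) :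
    schattenTrace p A = posTrace (CFC.rpow (star A * A) (p / 2)) := by
  have h : CFC.rpow (CFC.abs A) p = CFC.rpow (star A * A) (p / 2) := by
    rw [CFC.abs, CFC.sqrt_eq_rpow, CFC.rpow_eq_pow, CFC.rpow_eq_pow,
      CFC.rpow_rpow_of_exponent_nonneg _ _ _ (by norm_num) hp (star_mul_self_nonneg A)]
    congr 1
    ring
  rw [schattenTrace, h]

theorem schattenNorm_rpow (A : H →L[ℂ] H) {p : ℝ} (hp : 0 < p) :
    schattenNorm p A ^ p = (schattenTrace p A).toReal := by
  rw [schattenNorm, one_div, Real.rpow_inv_rpow ENNReal.toReal_nonneg hp.ne']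

theorem posTrace_rpow_smul {T : H →L[ℂ] H} (hT : 0 ≤ T) (hc : IsCompactOperator T) {c q : ℝ}
    (hc0 : 0 ≤ c) (hq : 0 ≤ q) :
    posTrace (CFC.rpow ((c : ℂ) • T) q) = ENNReal.ofReal (c ^ q) * posTrace (CFC.rpow T q) := by
  obtain ⟨ι, b, l, h⟩ := exists_isEigenbasis hT hc
  have hcT : 0 ≤ (c : ℂ) • T := by
    rw [ContinuousLinearMap.nonneg_iff_isPositive] at hT ⊢
    exact hT.smul_of_nonneg (Complex.zero_le_real.2 hc0)
  have h' : IsEigenbasis ((c : ℂ) • T) b (fun k => c * l k) :=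
    ⟨fun k => mul_nonneg hc0 (h.nonneg k), fun k => by
      rw [smul_apply, h.apply_eq, smul_smul, Complex.ofReal_mul]⟩
  rw [h.posTrace_rpow_eq hT hq, h'.posTrace_rpow_eq hcT hq, ← ENNReal.tsum_mul_left]
  refine tsum_congr fun k => ?_
  rw [Real.mul_rpow hc0 (h.nonneg k), ENNReal.ofReal_mul (Real.rpow_nonneg hc0 q)]

theorem isCompactOperator_star_mul_self {A : H →L[ℂ] H} (hA : IsCompactOperator A) :
    IsCompactOperator (star A * A : H →L[ℂ] H) :=
  hA.clm_comp (star A)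

variable {κ κ' : Type*} [Fintype κ] [Fintype κ'] {A : κ → H →L[ℂ] H} {D : κ' → H →L[ℂ] H}
  {c p : ℝ}

theorem posTrace_rpow_smul_sum (hA : ∀ i, IsCompactOperator (A i)) (hc : 0 ≤ c) (hp : 0 ≤ p) :
    posTrace (CFC.rpow ((c : ℂ) • ∑ i, star (A i) * A i) (p / 2)) =
      ENNReal.ofReal (c ^ (p / 2)) * posTrace (CFC.rpow (∑ i, star (A i) * A i) (p / 2)) :=
  posTrace_rpow_smul (Finset.sum_nonneg fun i _ => star_mul_self_nonneg (A i))
    (isCompactOperator_sum fun i => isCompactOperator_star_mul_self (hA i)) hc (by linarith)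

/-- Concavity on the A side and subadditivity on the D side, joined by the quadratic identity `h`.
-/
theorem mul_sum_schattenTrace_le (hA : ∀ i, IsCompactOperator (A i))
    (hD : ∀ i, IsCompactOperator (D i)) (hc : 0 ≤ c)
    (h : ∑ i, star (D i) * D i = (c : ℂ) • ∑ i, star (A i) * A i) (hp0 : 0 < p) (hp : p ≤ 2) :
    ENNReal.ofReal (c ^ (p / 2) * (Fintype.card κ : ℝ) ^ (p / 2 - 1)) * ∑ i, schattenTrace p (A i)
      ≤ ∑ i, schattenTrace p (D i) := by
  simp only [schattenTrace_eq _ hp0.le]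
  calc _ ≤ posTrace (CFC.rpow (∑ i, star (D i) * D i) (p / 2)) := by
        rw [h, posTrace_rpow_smul_sum hA hc hp0.le, ENNReal.ofReal_mul (by positivity), mul_assoc]
        gcongr
        exact le_posTrace_rpow_sum (fun i => star_mul_self_nonneg (A i))
          (fun i => isCompactOperator_star_mul_self (hA i)) (by linarith) (by linarith)
    _ ≤ _ := posTrace_rpow_sum_le_sum (fun i => star_mul_self_nonneg (D i))
          (fun i => isCompactOperator_star_mul_self (hD i)) (by linarith) (by linarith)

theorem sum_schattenTrace_le_mul (hA : ∀ i, IsCompactOperator (A i))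
    (hD : ∀ i, IsCompactOperator (D i)) (hc : 0 ≤ c)
    (h : ∑ i, star (D i) * D i = (c : ℂ) • ∑ i, star (A i) * A i) (hp : 2 ≤ p) :
    ∑ i, schattenTrace p (D i) ≤
      ENNReal.ofReal (c ^ (p / 2) * (Fintype.card κ : ℝ) ^ (p / 2 - 1)) *
        ∑ i, schattenTrace p (A i) := by
  have hp0 : 0 ≤ p := by linarith
  simp only [schattenTrace_eq _ hp0]
  calc _ ≤ posTrace (CFC.rpow (∑ i, star (D i) * D i) (p / 2)) :=
        sum_posTrace_rpow_le (fun i => star_mul_self_nonneg (D i))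
          (fun i => isCompactOperator_star_mul_self (hD i)) (by linarith)
    _ ≤ _ := by
        rw [h, posTrace_rpow_smul_sum hA hc hp0, ENNReal.ofReal_mul (by positivity), mul_assoc]
        gcongr
        exact posTrace_rpow_sum_le (fun i => star_mul_self_nonneg (A i))
          (fun i => isCompactOperator_star_mul_self (hA i)) (by linarith)

/-- Finiteness of the trace for a single D: subadditivity serves p ≤ 2, convexity p ≥ 2. -/
theorem schattenTrace_lt_top_of_star_mul_self_eq {D : H →L[ℂ] H} (hA : ∀ i, A i ∈ schattenClass H p)
    (hc : 0 ≤ c) (h : star D * D = (c : ℂ) • ∑ i, star (A i) * A i) (hp0 : 0 < p) :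
    schattenTrace p D < ∞ := by
  have hsum : ∑ i, schattenTrace p (A i) < ∞ := ENNReal.sum_lt_top.2 fun i _ => (hA i).2
  rw [schattenTrace_eq _ hp0.le, h, posTrace_rpow_smul_sum (fun i => (hA i).1) hc hp0.le]
  simp only [schattenTrace_eq _ hp0.le] at hsum
  refine ENNReal.mul_lt_top ENNReal.ofReal_lt_top ?_
  rcases le_total p 2 with hp | hp
  · exact (posTrace_rpow_sum_le_sum (fun i => star_mul_self_nonneg (A i))
      (fun i => isCompactOperator_star_mul_self (hA i).1) (by linarith) (by linarith)).trans_lt hsum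
  · exact (posTrace_rpow_sum_le (fun i => star_mul_self_nonneg (A i))
      (fun i => isCompactOperator_star_mul_self (hA i).1) (by linarith)).trans_lt
      (ENNReal.mul_lt_top ENNReal.ofReal_lt_top hsum)

theorem mul_sum_schattenNorm_rpow_le (hA : ∀ i, A i ∈ schattenClass H p)
    (hD : ∀ i, D i ∈ schattenClass H p) (hc : 0 ≤ c)
    (h : ∑ i, star (D i) * D i = (c : ℂ) • ∑ i, star (A i) * A i) (hp0 : 0 < p) (hp : p ≤ 2) :
    c ^ (p / 2) * (Fintype.card κ : ℝ) ^ (p / 2 - 1) * ∑ i, schattenNorm p (A i) ^ p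
      ≤ ∑ i, schattenNorm p (D i) ^ p := by
  simp only [schattenNorm_rpow _ hp0]
  rw [← ENNReal.toReal_sum fun i _ => (hA i).2.ne, ← ENNReal.toReal_sum fun i _ => (hD i).2.ne,
    ← ENNReal.toReal_ofReal_mul _ _ (by positivity)]
  exact ENNReal.toReal_mono (ENNReal.sum_lt_top.2 fun i _ => (hD i).2).ne
    (mul_sum_schattenTrace_le (fun i => (hA i).1) (fun i => (hD i).1) hc h hp0 hp)

theorem sum_schattenNorm_rpow_le_mul (hA : ∀ i, A i ∈ schattenClass H p)
    (hD : ∀ i, D i ∈ schattenClass H p) (hc : 0 ≤ c)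
    (h : ∑ i, star (D i) * D i = (c : ℂ) • ∑ i, star (A i) * A i) (hp : 2 ≤ p) :
    ∑ i, schattenNorm p (D i) ^ p ≤
      c ^ (p / 2) * (Fintype.card κ : ℝ) ^ (p / 2 - 1) * ∑ i, schattenNorm p (A i) ^ p := by
  simp only [schattenNorm_rpow _ (show 0 < p by linarith)]
  rw [← ENNReal.toReal_sum fun i _ => (hA i).2.ne, ← ENNReal.toReal_sum fun i _ => (hD i).2.ne,
    ← ENNReal.toReal_ofReal_mul _ _ (by positivity)]
  exact ENNReal.toReal_mono
    (ENNReal.mul_lt_top ENNReal.ofReal_lt_top (ENNReal.sum_lt_top.2 fun i _ => (hA i).2)).ne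
    (sum_schattenTrace_le_mul (fun i => (hA i).1) (fun i => (hD i).1) hc h hp)

theorem star_mul_eq_zero_of_range_isOrtho {A B : H →L[ℂ] H}
    (h : LinearMap.range (A : H →ₗ[ℂ] H) ⟂ LinearMap.range (B : H →ₗ[ℂ] H)) : star A * B = 0 := by
  ext x
  refine ext_inner_left ℂ fun y => ?_
  rw [mul_apply_eq_comp, ContinuousLinearMap.star_eq_adjoint,
    ContinuousLinearMap.adjoint_inner_right, zero_apply, inner_zero_right]
  exact (Submodule.isOrtho_iff_inner_eq.1 h) _ ⟨y, rfl⟩ _ ⟨x, rfl⟩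

variable [DecidableEq κ]

omit [Fintype κ] in
-- Cross terms vanish off the diagonal; on it |2A_i|² = 4|A_i|² exceeds the generic value by
-- 2|A_i|².
theorem star_add_mul_add_eq (h : ∀ i j, i ≠ j → star (A i) * A j = 0) (i j : κ) :
    star (A i + A j) * (A i + A j) = star (A i) * A i + star (A j) * A j +
      if i = j then (2 : ℂ) • (star (A i) * A i) else 0 := by
  split_ifs with hij
  · subst hij
    rw [two_smul, star_add]
    noncomm_ring
  · rw [star_add, add_mul, mul_add, mul_add, h i j hij, h j i (Ne.symm hij)]
    abel

omit [Fintype κ] in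
theorem star_sub_mul_sub_eq (h : ∀ i j, i ≠ j → star (A i) * A j = 0) (i j : κ) :
    star (A i - A j) * (A i - A j) = star (A i) * A i + star (A j) * A j -
      if i = j then (2 : ℂ) • (star (A i) * A i) else 0 := by
  split_ifs with hij
  · subst hij
    rw [two_smul]
    simp
  · rw [star_sub, sub_mul, mul_sub, mul_sub, h i j hij, h j i (Ne.symm hij)]
    abel

/-- Each |A_i|² occurs n times through either index, and twice more from the diagonal. -/
theorem sum_star_add_mul_add_eq (h : ∀ i j, i ≠ j → star (A i) * A j = 0) :
    ∑ x : κ × κ, star (A x.1 + A x.2) * (A x.1 + A x.2) =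
      ((2 * (Fintype.card κ : ℝ) + 2 : ℝ) : ℂ) • ∑ i, star (A i) * A i := by
  simp only [star_add_mul_add_eq h, Fintype.sum_prod_type, Finset.sum_add_distrib,
    Finset.sum_ite_eq, Finset.sum_const, Finset.mem_univ, if_true, Finset.card_univ,
    ← Finset.smul_sum, ← Nat.cast_smul_eq_nsmul ℂ]
  push_cast
  module

theorem sum_star_sub_mul_sub_eq (h : ∀ i j, i ≠ j → star (A i) * A j = 0) :
    ∑ x : κ × κ, star (A x.1 - A x.2) * (A x.1 - A x.2) =
      ((2 * (Fintype.card κ : ℝ) - 2 : ℝ) : ℂ) • ∑ i, star (A i) * A i := by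
  simp only [star_sub_mul_sub_eq h, Fintype.sum_prod_type, Finset.sum_add_distrib,
    Finset.sum_sub_distrib, Finset.sum_ite_eq, Finset.sum_const, Finset.mem_univ, if_true,
    Finset.card_univ, ← Finset.smul_sum, ← Nat.cast_smul_eq_nsmul ℂ]
  push_cast
  module

omit [Fintype κ] in
theorem add_mem_schattenClass (hA : ∀ i, A i ∈ schattenClass H p)
    (h : ∀ i j, i ≠ j → star (A i) * A j = 0) (hp : 0 < p) (i j : κ) :
    A i + A j ∈ schattenClass H p := by
  refine ⟨(hA i).1.add (hA j).1, ?_⟩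
  refine schattenTrace_lt_top_of_star_mul_self_eq (A := ![A i, A j]) (c := if i = j then 2 else 1)
    (by simp [Fin.forall_fin_two, hA]) (by split_ifs <;> norm_num) ?_ hp
  rw [star_add_mul_add_eq h, Fin.sum_univ_two]
  split_ifs with hij
  · subst hij
    simp only [Matrix.cons_val_zero, Matrix.cons_val_one]
    push_cast
    module
  · simp

omit [Fintype κ] in
theorem sub_mem_schattenClass (hA : ∀ i, A i ∈ schattenClass H p)
    (h : ∀ i j, i ≠ j → star (A i) * A j = 0) (hp : 0 < p) (i j : κ) :
    A i - A j ∈ schattenClass H p := by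
  refine ⟨(hA i).1.sub (hA j).1, ?_⟩
  -- On the diagonal the difference is zero, hence c = 0.
  refine schattenTrace_lt_top_of_star_mul_self_eq (A := ![A i, A j]) (c := if i = j then 0 else 1)
    (by simp [Fin.forall_fin_two, hA]) (by split_ifs <;> norm_num) ?_ hp
  rw [star_sub_mul_sub_eq h, Fin.sum_univ_two]
  split_ifs with hij
  · subst hij
    simp only [Matrix.cons_val_zero, Matrix.cons_val_one]
    push_cast
    module
  · simp

end Schatten

/-! ### The theorem. -/

theorem mainTheorem5 {H : Type*} [NormedAddCommGroup H] [InnerProductSpace ℂ H]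
    [CompleteSpace H] [TopologicalSpace.SeparableSpace H]
    (n : ℕ) (p : ℝ) (hp : 0 < p) (A : Fin n → H →L[ℂ] H)
    (hA : ∀ i, A i ∈ schattenClass H p)
    (hran : ∀ i j, i ≠ j →
      LinearMap.range (A i : H →ₗ[ℂ] H) ⟂ LinearMap.range (A j : H →ₗ[ℂ] H)) :
    (∀ i j, A i + A j ∈ schattenClass H p ∧ A i - A j ∈ schattenClass H p) ∧
    (p ≤ 2 →
      (2 * (n : ℝ) + 2) ^ (p / 2) * (n : ℝ) ^ (p / 2 - 1) * ∑ i, schattenNorm p (A i) ^ p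
        ≤ ∑ i, ∑ j, schattenNorm p (A i + A j) ^ p ∧
      (2 * (n : ℝ) - 2) ^ (p / 2) * (n : ℝ) ^ (p / 2 - 1) * ∑ i, schattenNorm p (A i) ^ p
        ≤ ∑ i, ∑ j, schattenNorm p (A i - A j) ^ p) ∧
    (2 ≤ p →
      ∑ i, ∑ j, schattenNorm p (A i + A j) ^ p
        ≤ (2 * (n : ℝ) + 2) ^ (p / 2) * (n : ℝ) ^ (p / 2 - 1) * ∑ i, schattenNorm p (A i) ^ p ∧
      ∑ i, ∑ j, schattenNorm p (A i - A j) ^ p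
        ≤ (2 * (n : ℝ) - 2) ^ (p / 2) * (n : ℝ) ^ (p / 2 - 1) * ∑ i, schattenNorm p (A i) ^ p) := by
  have h : ∀ i j, i ≠ j → star (A i) * A j = 0 :=
    fun i j hij => star_mul_eq_zero_of_range_isOrtho (hran i j hij)
  have hadd := add_mem_schattenClass hA h hp
  have hsub := sub_mem_schattenClass hA h hp
  refine ⟨fun i j => ⟨hadd i j, hsub i j⟩, ?_⟩
  -- For n = 0 the constant 2n - 2 is negative, but all sums are empty.
  rcases n.eq_zero_or_pos with rfl | hn
  · simp
  have hn1 : (1 : ℝ) ≤ n := by exact_mod_cast hn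
  have hsum := sum_star_add_mul_add_eq h
  have hdif := sum_star_sub_mul_sub_eq h
  have hc1 : (0 : ℝ) ≤ 2 * (Fintype.card (Fin n) : ℝ) + 2 := by positivity
  have hc2 : (0 : ℝ) ≤ 2 * (Fintype.card (Fin n) : ℝ) - 2 := by
    rw [Fintype.card_fin]
    linarith
  refine ⟨fun hp2 => ⟨?_, ?_⟩, fun hp2 => ⟨?_, ?_⟩⟩
  · simpa only [Fintype.card_fin, Fintype.sum_prod_type] using
      mul_sum_schattenNorm_rpow_le hA (fun x : Fin n × Fin n => hadd x.1 x.2) hc1 hsum hp hp2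
  · simpa only [Fintype.card_fin, Fintype.sum_prod_type] using
      mul_sum_schattenNorm_rpow_le hA (fun x : Fin n × Fin n => hsub x.1 x.2) hc2 hdif hp hp2
  · simpa only [Fintype.card_fin, Fintype.sum_prod_type] using
      sum_schattenNorm_rpow_le_mul hA (fun x : Fin n × Fin n => hadd x.1 x.2) hc1 hsum hp2
  · simpa only [Fintype.card_fin, Fintype.sum_prod_type] using
      sum_schattenNorm_rpow_le_mul hA (fun x : Fin n × Fin n => hsub x.1 x.2) hc2 hdif hp2
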